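/- Let $k$ be a field of characteristic zero and let $C$ be a smooth projective (integral) curve over $k$. Let $X$ and $Y$ be projective schemes over $C$ with $Y$ reduced, and assume that $X\to C$ is a trivial family, i.e. there is a $k$-scheme $X_0$ and an isomorphism $X\cong X_0\times_k C$ over $C$. Let $g\colon X\to Y$ be a morphism over $C$ such that $g^{\#}\colon \mathcal O_Y\to g_*\mathcal O_X$ is an isomorphism. Let $U\subset C$ be a nonempty open subset over which $Y$ is flat, let $Q\in U$ be a point, and let $R=\mathcal O_{C,Q}$ be the local ring at $Q$. Put $Y_R=Y\times_C\operatorname{Spec}R$, with projection $p\colon Y_R\to\operatorname{Spec}R$. Then the canonical sequence of differentials of $Y_R\xrightarrow{\,p\,}\operatorname{Spec}R\to\operatorname{Spec}k$, $$0\to p^*\Omega_{R/k}\to\Omega_{Y_R/k}\to\Omega_{Y_R/R}\to 0,$$ is a split exact sequence of $\mathcal O_{Y_R}$-modules. -/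

import Mathlib

universe u

open CategoryTheory Limits AlgebraicGeometry

noncomputable section

namespace SchemeDiff

variable {X S T : Scheme.{u}}

/-! ### Derivations and the sheaf of relative differentials -/

/-- For `f : X ⟶ S` and an `𝒪_X`-module `M`: the `𝒪_S`-derivations `D : 𝒪_X → M`, i.e. families of
additive maps `Γ(X, U) → Γ(M, U)`, compatible with restriction, that satisfy the Leibniz rule and
vanish on the image of `Γ(S, V) → Γ(X, f⁻¹ V)` for every open `V` of `S`. -/
abbrev Der (f : X ⟶ S) (M : X.Modules) : Type u :=
  PresheafOfModules.Derivation (F := TopologicalSpace.Opens.map f.base) (R := X.presheaf)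
    ((Scheme.Modules.toPresheafOfModules X).obj M) f.c

/-- The map `f⁻¹𝒪_S → 𝒪_X` adjoint to `f^♯ : 𝒪_S → f_*𝒪_X`, where `f⁻¹` is the inverse image of
presheaves of rings. -/
def inverseImageToStructure (f : X ⟶ S) :
    (TopCat.Presheaf.pullback CommRingCat f.base).obj S.presheaf ⟶ X.presheaf :=
  ((TopCat.Presheaf.pullbackPushforwardAdjunction CommRingCat f.base).homEquiv _ _).symm f.c

/-- The presheaf of modules `U ↦ Ω_{𝒪_X(U) / (f⁻¹𝒪_S)(U)}` of Kähler differentials. -/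
def presheafOmega (f : X ⟶ S) : X.PresheafOfModules :=
  PresheafOfModules.DifferentialsConstruction.relativeDifferentials' (inverseImageToStructure f)

/-- The sheaf of relative differentials `Ω_{X/S}` of `f : X ⟶ S`: the `𝒪_X`-module associated with
the presheaf `U ↦ Ω_{𝒪_X(U) / (f⁻¹𝒪_S)(U)}`. -/
def Omega (f : X ⟶ S) : X.Modules :=
  (PresheafOfModules.sheafification (𝟙 X.ringCatSheaf.obj)).obj (presheafOmega f)

/-! ### The universal property of `Ω_{X/S}` -/

/-- The universal property of sheafification, for `Ω_{X/S}`. -/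
def homEquivPresheaf (f : X ⟶ S) (M : X.Modules) :
    (Omega f ⟶ M) ≃ (presheafOmega f ⟶ (Scheme.Modules.toPresheafOfModules X).obj M) :=
  PresheafOfModules.sheafificationHomEquiv (𝟙 X.ringCatSheaf.obj) (F := M)

lemma homEquivPresheaf_comp (f : X ⟶ S) {M N : X.Modules} (a : Omega f ⟶ M) (b : M ⟶ N) :
    homEquivPresheaf f N (a ≫ b) =
      homEquivPresheaf f M a ≫ (Scheme.Modules.toPresheafOfModules X).map b :=
  (PresheafOfModules.sheafificationAdjunction
    (𝟙 X.ringCatSheaf.obj)).homEquiv_naturality_right a b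

/-- The subring of elements killed by a derivation. -/
def derKer {f : X ⟶ S} {M : X.Modules} (D : Der f M) (U : (TopologicalSpace.Opens X)ᵒᵖ) :
    Subring (X.presheaf.obj U) where
  carrier := {a | D.d a = 0}
  mul_mem' := fun {a b} ha hb => by
    change D.d (a * b) = 0
    rw [D.d_mul, show D.d a = 0 from ha, show D.d b = 0 from hb, smul_zero, smul_zero, add_zero]
  one_mem' := D.d_one _
  add_mem' := fun {a b} ha hb => by
    change D.d (a + b) = 0
    rw [map_add, show D.d a = 0 from ha, show D.d b = 0 from hb, add_zero]
  zero_mem' := map_zero _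
  neg_mem' := fun {a} ha => by
    change D.d (-a) = 0
    rw [map_neg, show D.d a = 0 from ha, neg_zero]

/-- The presheaf of rings formed by the subrings `derKer D U`. -/
def derKerPresheaf {f : X ⟶ S} {M : X.Modules} (D : Der f M) :
    TopCat.Presheaf CommRingCat.{u} X where
  obj U := CommRingCat.of (derKer D U)
  map {U V} i := CommRingCat.ofHom ((X.presheaf.map i).hom.restrict (derKer D U) (derKer D V)
    (fun a ha => by
      change D.d _ = 0
      rw [D.d_map, show D.d a = 0 from ha, map_zero]
      rfl))
  map_id U := by
    ext a
    exact congr($(X.presheaf.map_id U) (show derKer D U from a).1)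
  map_comp {U V W} i j := by
    ext a
    exact congr($(X.presheaf.map_comp i j) (show derKer D U from a).1)

/-- The inclusion of `derKerPresheaf D` into the structure sheaf. -/
def derKerι {f : X ⟶ S} {M : X.Modules} (D : Der f M) : derKerPresheaf D ⟶ X.presheaf where
  app U := CommRingCat.ofHom (derKer D U).subtype
  naturality _ _ _ := rfl

/-- `f^♯` lands in the kernel of an `𝒪_S`-derivation. -/
def toDerKer {f : X ⟶ S} {M : X.Modules} (D : Der f M) :
    S.presheaf ⟶ (TopCat.Presheaf.pushforward CommRingCat f.base).obj (derKerPresheaf D) where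
  app V := CommRingCat.ofHom ((f.c.app V).hom.codRestrict (derKer D _) (fun a => D.d_app a))
  naturality _ _ i := by
    ext a
    apply Subtype.ext
    exact congr($(f.c.naturality i) a)

/-- An `𝒪_S`-derivation vanishes on the image of `f⁻¹𝒪_S`. -/
lemma Der.d_inverseImage {f : X ⟶ S} {M : X.Modules} (D : Der f M)
    (U : (TopologicalSpace.Opens X)ᵒᵖ)
    (a : ((TopCat.Presheaf.pullback CommRingCat f.base).obj S.presheaf).obj U) :
    D.d ((inverseImageToStructure f).app U a) = 0 := by
  have h : inverseImageToStructure f =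
      ((TopCat.Presheaf.pullbackPushforwardAdjunction CommRingCat f.base).homEquiv _ _).symm
        (toDerKer D) ≫ derKerι D := by
    rw [← Adjunction.homEquiv_naturality_right_symm]
    rfl
  rw [h]
  exact (show derKer D U from
    (((TopCat.Presheaf.pullbackPushforwardAdjunction CommRingCat f.base).homEquiv _ _).symm
        (toDerKer D)).app U a).2

/-- An `𝒪_S`-derivation is an `f⁻¹𝒪_S`-derivation. -/
def Der.toDer' {f : X ⟶ S} {M : X.Modules} (D : Der f M) :
    PresheafOfModules.Derivation' (R := X.presheaf)
      ((Scheme.Modules.toPresheafOfModules X).obj M) (inverseImageToStructure f) where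
  d := D.d
  d_mul := D.d_mul
  d_map := D.d_map
  d_app a := D.d_inverseImage _ a

/-- An `f⁻¹𝒪_S`-derivation is an `𝒪_S`-derivation. -/
def Der.ofDer' {f : X ⟶ S} {M : X.Modules}
    (D : PresheafOfModules.Derivation' (R := X.presheaf)
      ((Scheme.Modules.toPresheafOfModules X).obj M) (inverseImageToStructure f)) : Der f M where
  d := D.d
  d_mul := D.d_mul
  d_map := D.d_map
  d_app {V} a := by
    have h : f.c.app V =
        ((TopCat.Presheaf.pullbackPushforwardAdjunction CommRingCat f.base).unit.app
          S.presheaf).app V ≫ (inverseImageToStructure f).app _ :=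
      congr(($(((TopCat.Presheaf.pullbackPushforwardAdjunction CommRingCat
        f.base).homEquiv _ _).apply_symm_apply f.c)).app V).symm.trans
          (by rw [Adjunction.homEquiv_unit]; rfl)
    exact (congrArg _ congr($h a)).trans (PresheafOfModules.Derivation.d_app D _)

/-- The universal property of the presheaf of differentials. -/
def derEquivPresheaf (f : X ⟶ S) (M : X.Modules) :
    (presheafOmega f ⟶ (Scheme.Modules.toPresheafOfModules X).obj M) ≃ Der f M where
  toFun φ := Der.ofDer'
    ((PresheafOfModules.DifferentialsConstruction.derivation'
      (inverseImageToStructure f)).postcomp φ)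
  invFun D := (PresheafOfModules.DifferentialsConstruction.isUniversal'
    (inverseImageToStructure f)).desc D.toDer'
  left_inv φ := by
    apply (PresheafOfModules.DifferentialsConstruction.isUniversal'
      (inverseImageToStructure f)).postcomp_injective
    exact ((PresheafOfModules.DifferentialsConstruction.isUniversal'
      (inverseImageToStructure f)).fac _).trans rfl
  right_inv D := by
    have := (PresheafOfModules.DifferentialsConstruction.isUniversal'
      (inverseImageToStructure f)).fac D.toDer'
    ext U a
    exact PresheafOfModules.Derivation.congr_d this a

/-- The universal property `Hom(Ω_{X/S}, M) ≃ Der_S(𝒪_X, M)`. -/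
def homEquivDer (f : X ⟶ S) (M : X.Modules) : (Omega f ⟶ M) ≃ Der f M :=
  (homEquivPresheaf f M).trans (derEquivPresheaf f M)

lemma homEquivDer_comp_d (f : X ⟶ S) {M N : X.Modules} (a : Omega f ⟶ M) (b : M ⟶ N)
    (U : X.Opens) (x : Γ(X, U)) :
    (homEquivDer f N (a ≫ b)).d (X := .op U) x =
      b.app U ((homEquivDer f M a).d (X := .op U) x) := by
  simp only [homEquivDer, Equiv.trans_apply, homEquivPresheaf_comp]
  rfl

/-- The universal derivation `d_{X/S} : 𝒪_X → Ω_{X/S}`. -/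
def univDer (f : X ⟶ S) : Der f (Omega f) := homEquivDer f _ (𝟙 _)

/-- The morphism `Ω_{X/S} ⟶ M` with `d_{X/S} a ↦ D a`. -/
def desc {f : X ⟶ S} {M : X.Modules} (D : Der f M) : Omega f ⟶ M := (homEquivDer f M).symm D

lemma hom_app_univDer {f : X ⟶ S} {M : X.Modules} (φ : Omega f ⟶ M) (U : X.Opens) (x : Γ(X, U)) :
    φ.app U ((univDer f).d (X := .op U) x) = (homEquivDer f M φ).d (X := .op U) x := by
  rw [univDer, ← homEquivDer_comp_d, Category.id_comp]

lemma desc_app_univDer {f : X ⟶ S} {M : X.Modules} (D : Der f M) (U : X.Opens) (x : Γ(X, U)) :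
    (desc D).app U ((univDer f).d (X := .op U) x) = D.d (X := .op U) x := by
  rw [hom_app_univDer, desc, Equiv.apply_symm_apply]

lemma Omega_hom_ext {f : X ⟶ S} {M : X.Modules} {φ ψ : Omega f ⟶ M}
    (h : ∀ (U : X.Opens) (x : Γ(X, U)),
      φ.app U ((univDer f).d (X := .op U) x) = ψ.app U ((univDer f).d (X := .op U) x)) :
    φ = ψ := by
  apply (homEquivDer f M).injective
  ext U x
  have := h U.unop x
  rw [hom_app_univDer, hom_app_univDer] at this
  exact this

/-! ### The sequence of differentials of `X ⟶ S ⟶ T` -/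

/-- An `𝒪_S`-derivation on `X` is in particular an `𝒪_T`-derivation. -/
def Der.restrictBase {p : X ⟶ S} (r : S ⟶ T) {M : X.Modules} (D : Der p M) : Der (p ≫ r) M where
  d := D.d
  d_mul := D.d_mul
  d_map := D.d_map
  d_app a := D.d_app (r.c.app _ a)

/-- An `𝒪_T`-derivation `𝒪_X → M` induces an `𝒪_T`-derivation `𝒪_S → p_*𝒪_X → p_*M`. -/
def Der.push (p : X ⟶ S) (r : S ⟶ T) {M : X.Modules} (D : Der (p ≫ r) M) :
    Der r ((Scheme.Modules.pushforward p).obj M) where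
  d {V} := (D.d (X := (TopologicalSpace.Opens.map p.base).op.obj V)).comp
    (p.c.app V).hom.toAddMonoidHom
  d_mul {V} a b := by
    change D.d (p.c.app V (a * b)) = _
    rw [map_mul, D.d_mul]
    rfl
  d_map {V W} i x := by
    change D.d (p.c.app W (S.presheaf.map i x)) = _
    exact (congrArg D.d congr($(p.c.naturality i) x)).trans (D.d_map _ _)
  d_app a := D.d_app a

/-- The map `Ω_{X/T} ⟶ Ω_{X/S}`, `d_{X/T} a ↦ d_{X/S} a`. -/
def omegaToRel (p : X ⟶ S) (r : S ⟶ T) : Omega (p ≫ r) ⟶ Omega p :=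
  desc ((univDer p).restrictBase r)

/-- The map `Ω_{S/T} ⟶ p_*Ω_{X/T}`, `d_{S/T} a ↦ d_{X/T} (p^♯ a)`. -/
def omegaToPushforward (p : X ⟶ S) (r : S ⟶ T) :
    Omega r ⟶ (Scheme.Modules.pushforward p).obj (Omega (p ≫ r)) :=
  desc ((univDer (p ≫ r)).push p r)

/-- The map `p^*Ω_{S/T} ⟶ Ω_{X/T}` adjoint to `omegaToPushforward`. -/
def pullbackOmegaTo (p : X ⟶ S) (r : S ⟶ T) :
    (Scheme.Modules.pullback p).obj (Omega r) ⟶ Omega (p ≫ r) :=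
  ((Scheme.Modules.pullbackPushforwardAdjunction p).homEquiv _ _).symm (omegaToPushforward p r)

lemma pullbackOmegaTo_comp (p : X ⟶ S) (r : S ⟶ T) :
    pullbackOmegaTo p r ≫ omegaToRel p r = 0 := by
  rw [pullbackOmegaTo, ← Adjunction.homEquiv_naturality_right_symm, Equiv.symm_apply_eq,
    Adjunction.homEquiv_unit, Functor.map_zero, comp_zero]
  apply Omega_hom_ext
  intro V x
  rw [omegaToPushforward, Scheme.Modules.Hom.comp_app, Scheme.Modules.Hom.zero_app]
  change ((Scheme.Modules.pushforward p).map (omegaToRel p r)).app V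
    ((desc ((univDer (p ≫ r)).push p r)).app V ((univDer r).d (X := .op V) x)) = 0
  rw [desc_app_univDer, Scheme.Modules.pushforward_map_app]
  exact (desc_app_univDer ((univDer p).restrictBase r) (p ⁻¹ᵁ V) (p.c.app (.op V) x)).trans
    ((univDer p).d_app x)

/-- The sequence of differentials `p^*Ω_{S/T} ⟶ Ω_{X/T} ⟶ Ω_{X/S}` of `X ⟶ S ⟶ T`, a complex of
`𝒪_X`-modules. -/
def diffSequence (p : X ⟶ S) (r : S ⟶ T) : ShortComplex X.Modules :=
  ShortComplex.mk (pullbackOmegaTo p r) (omegaToRel p r) (pullbackOmegaTo_comp p r)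

/-! ### Projective morphisms and trivial families -/

/-- The projective space `ℙⁿ` over `ℤ`, as `Proj ℤ[x₀, …, xₙ]`. -/
def projectiveSpaceInt (n : ℕ) : Scheme.{u} :=
  letI := MvPolynomial.gradedAlgebra (σ := Fin (n + 1)) (R := ULift.{u} ℤ)
  Proj (MvPolynomial.homogeneousSubmodule (Fin (n + 1)) (ULift.{u} ℤ))

/-- The projective space `ℙⁿ_S = S × ℙⁿ_ℤ` over a scheme `S`. -/
def projectiveSpace (n : ℕ) (S : Scheme.{u}) : Scheme.{u} :=
  pullback (terminal.from S) (terminal.from (projectiveSpaceInt.{u} n))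

/-- A morphism `f : X ⟶ S` is projective if it factors as a closed immersion into some `ℙⁿ_S`
followed by the projection to `S`. -/
def IsProjective (f : X ⟶ S) : Prop :=
  ∃ (n : ℕ) (i : X ⟶ projectiveSpace n S), IsClosedImmersion i ∧
    i ≫ pullback.fst (terminal.from S) (terminal.from (projectiveSpaceInt.{u} n)) = f

/-- A smooth projective curve over a field `k`, given by its structure morphism: an integral
scheme, projective and smooth of relative dimension one over `k`. -/
structure IsSmoothProjectiveCurve {k : Type u} [Field k] {C : Scheme.{u}}
    (c : C ⟶ Spec (CommRingCat.of k)) : Prop where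
  isIntegral : IsIntegral C
  smooth : SmoothOfRelativeDimension 1 c
  projective : IsProjective c

/-- A family `π : X ⟶ S` over a `k`-scheme `S` is trivial if there are a `k`-scheme `X₀` and an
isomorphism `X ≅ X₀ ×_k S` over `S`. (Such a `π` is automatically flat, `k` being a field.) -/
def IsTrivialFamily {k : Type u} [Field k] (s : S ⟶ Spec (CommRingCat.of k)) (π : X ⟶ S) : Prop :=
  ∃ (X₀ : Scheme.{u}) (x₀ : X₀ ⟶ Spec (CommRingCat.of k)) (e : X ≅ pullback x₀ s),
    e.hom ≫ pullback.snd x₀ s = π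

end SchemeDiff

end

/-! Near `Q` the curve has an affine open `V` on which the differentials over `k` are free of rank
one. The coordinate of `d` in a basis is a vector field `δ` on `V`, and every derivation out of
`Γ(C, V)` that kills the base has the form `a ↦ δ a • w`. On the trivial family `X₀ ×_k C` the field
`δ` lifts by acting as zero on `X₀`. A derivation of `𝒪_X` over preimages of opens of `Y` is a
derivation of `g_*𝒪_X = 𝒪_Y`, so the lift descends to `Y`. It then restricts to `Y_R`, because `Y_R
⟶ Y` is an isomorphism on local rings.

Let `Δ` be the resulting derivation on `Y_R`, and let `w` be the section of `Ω_{R/k}` with `d a = δ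
a • w`. The map `dy ↦ Δ y • p^*w` is a retraction of `p^*Ω_{R/k} ⟶ Ω_{Y_R/k}`: it has the right
value on functions coming from `V`, and derivations are determined by these because local rings of
`Spec R` are quotients of those of `C`. A retraction suffices: the complementary map `1 - ι ∘ ρ`
kills differentials of functions from the base, so it factors through `Ω_{Y_R/R}` and provides the
section.

The main steps are `exists_of_isStandardSmooth`, `Lifts.of_isPullback`, `Lifts.of_comp`,
`Lifts.comp`, `nonempty_splitting_of_lifts` and `nonempty_splitting_diffSequence`. -/

/-! ### Derivations of rings under localization, base change and smoothness -/

/-- `D : R → N` is a derivation along the ring homomorphism `φ : R → S`, where `N` is an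
`S`-module. -/
structure IsDerivationAlong {R S N : Type*} [CommRing R] [CommRing S] [AddCommGroup N] [Module S N]
    (φ : R →+* S) (D : R → N) : Prop where
  map_add : ∀ a b, D (a + b) = D a + D b
  leibniz : ∀ a b, D (a * b) = φ a • D b + φ b • D a

namespace IsDerivationAlong

section

variable {R S T N : Type*} [CommRing R] [CommRing S] [CommRing T] [AddCommGroup N] [Module S N]
  {φ : R →+* S} {D D' : R → N}

lemma map_zero (h : IsDerivationAlong φ D) : D 0 = 0 := by
  have := h.map_add 0 0
  simpa using this

lemma comp (h : IsDerivationAlong φ D) (ψ : T →+* R) :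
    IsDerivationAlong (φ.comp ψ) (fun x => D (ψ x)) where
  map_add a b := by rw [_root_.map_add, h.map_add]
  leibniz a b := by rw [_root_.map_mul, h.leibniz]; rfl

lemma postcomp {D : R → S} (h : IsDerivationAlong φ D) (ψ : S →+* T) :
    IsDerivationAlong (ψ.comp φ) (fun x => ψ (D x)) where
  map_add a b := by rw [h.map_add, _root_.map_add]
  leibniz a b := by simp [h.leibniz]

lemma sub (h : IsDerivationAlong φ D) (h' : IsDerivationAlong φ D') :
    IsDerivationAlong φ (fun x => D x - D' x) where
  map_add a b := by rw [h.map_add, h'.map_add]; abel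
  leibniz a b := by rw [h.leibniz, h'.leibniz, smul_sub, smul_sub]; abel

/-- The bundled derivation associated with a derivation along `algebraMap`. -/
def toDerivation (k : Type*) [CommRing k] [Algebra k R] [Algebra R S] [Module R N] [Module k N]
    [IsScalarTower R S N] [IsScalarTower k R N]
    (h : IsDerivationAlong (algebraMap R S) D) (h0 : ∀ r : k, D (algebraMap k R r) = 0) :
    Derivation k R N :=
  Derivation.mk'
    { toFun := D
      map_add' := h.map_add
      map_smul' := fun c x => by
        rw [Algebra.smul_def, h.leibniz, h0, smul_zero, add_zero, RingHom.id_apply,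
          algebraMap_smul, algebraMap_smul] }
    (fun a b => by
      change D (a * b) = _
      rw [h.leibniz, algebraMap_smul, algebraMap_smul]
      rfl)

end

/-- If `x * s = r`, the Leibniz rule expresses `s • D x` through the values of `D` on `r` and `s`,
and `s` acts invertibly. -/
lemma eq_of_isLocalization {R S T N : Type*} [CommRing R] [CommRing S] [CommRing T]
    [AddCommGroup N] [Module T N] [Algebra R S] (M : Submonoid R) [IsLocalization M S]
    {φ : S →+* T} {D D' : S → N} (h : IsDerivationAlong φ D) (h' : IsDerivationAlong φ D')
    (e : ∀ r : R, D (algebraMap R S r) = D' (algebraMap R S r)) : D = D' := by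
  ext x
  obtain ⟨⟨r, s⟩, hx⟩ := IsLocalization.surj M x
  have hs : IsUnit (φ (algebraMap R S s)) := (IsLocalization.map_units S s).map φ
  have h1 := h.leibniz x (algebraMap R S s)
  have h2 := h'.leibniz x (algebraMap R S s)
  rw [hx] at h1 h2
  rw [e, e, h2] at h1
  exact (hs.smul_left_cancel.mp (add_left_cancel h1)).symm

/-- Localizations are formally étale, so the differentials of `S` over `ℤ` are the base change of
those of `R`. -/
lemma exists_of_isLocalization {R S : Type u} [CommRing R] [CommRing S] [Algebra R S]
    (M : Submonoid R) [IsLocalization M S] {D : R → S}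
    (h : IsDerivationAlong (algebraMap R S) D) :
    ∃ D' : S → S, IsDerivationAlong (RingHom.id S) D' ∧
      ∀ r, D' (algebraMap R S r) = D r := by
  have : Algebra.FormallyEtale R S := Algebra.FormallyEtale.of_isLocalization M
  -- A derivation kills `1`, hence all integers, so `D` is linear over `ℤ`.
  have h0 (n : ℤ) : D (algebraMap ℤ R n) = 0 := by
    have : D = AddMonoidHom.mk' D h.map_add := rfl
    have h1 : D 1 = 0 := by simpa using h.leibniz 1 1
    rw [this, eq_intCast, ← zsmul_one, map_zsmul]
    simp [h1]
  let d : Derivation ℤ R S := h.toDerivation ℤ h0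
  let l : Ω[S⁄ℤ] →ₗ[S] S := (d.liftKaehlerDifferential.liftBaseChange S) ∘ₗ
    (KaehlerDifferential.tensorKaehlerEquivOfFormallyEtale ℤ R S).symm.toLinearMap
  refine ⟨fun x => l (KaehlerDifferential.D ℤ S x), ⟨by simp, fun a b => by simp⟩, fun r => ?_⟩
  simp only [l, LinearMap.comp_apply, LinearEquiv.coe_coe,
    KaehlerDifferential.tensorKaehlerEquivOfFormallyEtale_symm_D_algebraMap]
  simp
  rfl

lemma eq_of_isPushout {k A B R T N : Type*} [CommRing k] [CommRing A] [CommRing B] [CommRing R]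
    [CommRing T] [AddCommGroup N] [Module T N] [Algebra k A] [Algebra k B] [Algebra A R]
    [Algebra B R] [Algebra k R] [IsScalarTower k A R] [IsScalarTower k B R]
    [Algebra.IsPushout k A B R] {φ : R →+* T} {D D' : R → N}
    (h : IsDerivationAlong φ D) (h' : IsDerivationAlong φ D')
    (hA : ∀ a : A, D (algebraMap A R a) = D' (algebraMap A R a))
    (hB : ∀ b : B, D (algebraMap B R b) = D' (algebraMap B R b)) : D = D' := by
  ext x
  obtain ⟨x, rfl⟩ := (Algebra.IsPushout.equiv k A B R).surjective x
  induction x with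
  | zero => simp [h.map_zero, h'.map_zero]
  | add x y hx hy => rw [_root_.map_add, h.map_add, h'.map_add, hx, hy]
  | tmul a b => simp only [Algebra.IsPushout.equiv_tmul, h.leibniz, h'.leibniz, hA, hB]

/-- The differentials of `R` over `A` are the base change of those of `B` over `k`; working relative
to `A` makes the extension vanish on `A`. -/
lemma exists_of_isPushout {k A B R : Type u} [CommRing k] [CommRing A] [CommRing B] [CommRing R]
    [Algebra k A] [Algebra k B] [Algebra A R]
    [Algebra B R] [Algebra k R] [IsScalarTower k A R] [IsScalarTower k B R]
    [Algebra.IsPushout k A B R] {D : B → B}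
    (h : IsDerivationAlong (RingHom.id B) D) (h0 : ∀ r : k, D (algebraMap k B r) = 0) :
    ∃ D' : R → R, IsDerivationAlong (RingHom.id R) D' ∧
      (∀ a, D' (algebraMap A R a) = 0) ∧
      ∀ b, D' (algebraMap B R b) = algebraMap B R (D b) := by
  let d : Derivation k B R := (h.postcomp (algebraMap B R)).toDerivation k
    (fun r => by rw [h0, _root_.map_zero])
  let l : Ω[R⁄A] →ₗ[R] R := (d.liftKaehlerDifferential.liftBaseChange R) ∘ₗ
    (KaehlerDifferential.tensorKaehlerEquiv k A B R).symm.toLinearMap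
  refine ⟨fun x => l (KaehlerDifferential.D A R x), ⟨by simp, fun a b => by simp⟩,
    fun a => by simp, fun b => ?_⟩
  have : (KaehlerDifferential.tensorKaehlerEquiv k A B R).symm
      (KaehlerDifferential.D A R (algebraMap B R b)) = 1 ⊗ₜ KaehlerDifferential.D k B b := by
    rw [LinearEquiv.symm_apply_eq, KaehlerDifferential.tensorKaehlerEquiv_tmul_D, one_smul]
  simp only [l, LinearMap.comp_apply, LinearEquiv.coe_coe, this]
  simp
  rfl

/-- A standard smooth algebra of relative dimension one has a derivation `δ` through which all
derivations factor. -/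
lemma exists_of_isStandardSmooth {k A : Type u} [CommRing k] [CommRing A] (f : k →+* A)
    (hf : f.IsStandardSmoothOfRelativeDimension 1) :
    ∃ δ : A → A, IsDerivationAlong (RingHom.id A) δ ∧ (∀ r, δ (f r) = 0) ∧
      ∀ {B N : Type u} [CommRing B] [AddCommGroup N] [Module B N] (ψ : A →+* B) (D : A → N),
        IsDerivationAlong ψ D → (∀ r, D (f r) = 0) → ∃ w : N, ∀ a, D a = ψ (δ a) • w := by
  -- Over the zero ring every `D` vanishes, since `D a = D 0`.
  cases subsingleton_or_nontrivial A
  · refine ⟨fun _ => 0, ⟨by simp, by simp⟩, by simp, fun {B N} _ _ _ ψ D hD hD0 => ⟨0, fun a => ?_⟩⟩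
    rw [smul_zero, Subsingleton.elim a 0, hD.map_zero]
  algebraize [f]
  have hr : Module.rank A (Ω[A⁄k]) = 1 := by
    simpa using Algebra.IsStandardSmoothOfRelativeDimension.rank_kaehlerDifferential
      (R := k) (S := A) 1
  have : Algebra.IsStandardSmooth k A :=
    Algebra.IsStandardSmoothOfRelativeDimension.isStandardSmooth (n := 1)
  have hr' : Module.finrank A (Ω[A⁄k]) = 1 := by simp [Module.finrank, hr]
  let b : Module.Basis Unit A (Ω[A⁄k]) := Module.basisUnique Unit hr'
  refine ⟨fun a => b.repr (KaehlerDifferential.D k A a) (), ⟨by simp, by simp⟩, fun r => ?_,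
    fun {B N} _ _ _ ψ D hD hD0 => ?_⟩
  · change b.repr (KaehlerDifferential.D k A (algebraMap k A r)) () = 0
    simp
  · let : Algebra A B := ψ.toAlgebra
    let : Module A N := Module.compHom N ψ
    have : IsScalarTower A B N := ⟨fun x y z => mul_smul (ψ x) y z⟩
    let : Module k N := Module.compHom N f
    have : IsScalarTower k A N := ⟨fun x y z => by
      rw [Algebra.smul_def, mul_smul]
      rfl⟩
    let d : Derivation k A N := IsDerivationAlong.toDerivation k (S := B) hD hD0
    -- The vector `w` is the image of the basis element under the linear map induced by `D`; since
    -- `d a = δ a • b ()`, linearity gives the formula.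
    refine ⟨d.liftKaehlerDifferential (b ()), fun a => ?_⟩
    have h1 : D a = d.liftKaehlerDifferential (KaehlerDifferential.D k A a) :=
      (d.liftKaehlerDifferential_comp_D a).symm
    conv_lhs => rw [h1, ← b.sum_repr (KaehlerDifferential.D k A a)]
    simp
    rfl

end IsDerivationAlong

/-! ### Derivations on germs and basic opens of an affine open -/

namespace IsDerivationAlong

variable {X : Scheme.{u}} {W : X.Opens}

lemma eq_of_germ (hW : IsAffineOpen W) {x : X} (hx : x ∈ W) {T N : Type*} [CommRing T]
    [AddCommGroup N] [Module T N] {φ : X.presheaf.stalk x →+* T} {D D' : X.presheaf.stalk x → N}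
    (h : IsDerivationAlong φ D) (h' : IsDerivationAlong φ D')
    (e : ∀ s : Γ(X, W), D (X.presheaf.germ W x hx s) = D' (X.presheaf.germ W x hx s)) : D = D' := by
  let := X.presheaf.algebra_section_stalk ⟨x, hx⟩
  have := hW.isLocalization_stalk ⟨x, hx⟩
  exact eq_of_isLocalization (R := Γ(X, W)) (S := X.presheaf.stalk x)
    (hW.primeIdealOf ⟨x, hx⟩).asIdeal.primeCompl h h' e

lemma exists_germ (hW : IsAffineOpen W) {x : X} (hx : x ∈ W) {D : Γ(X, W) → Γ(X, W)}
    (h : IsDerivationAlong (RingHom.id _) D) :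
    ∃ D' : X.presheaf.stalk x → X.presheaf.stalk x, IsDerivationAlong (RingHom.id _) D' ∧
      ∀ s, D' (X.presheaf.germ W x hx s) = X.presheaf.germ W x hx (D s) := by
  let := X.presheaf.algebra_section_stalk ⟨x, hx⟩
  have := hW.isLocalization_stalk ⟨x, hx⟩
  exact exists_of_isLocalization (R := Γ(X, W)) (S := X.presheaf.stalk x)
    (hW.primeIdealOf ⟨x, hx⟩).asIdeal.primeCompl
    (h.postcomp (algebraMap Γ(X, W) (X.presheaf.stalk x)))

lemma eq_of_basicOpen (hW : IsAffineOpen W) (f : Γ(X, W)) {T N : Type*} [CommRing T]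
    [AddCommGroup N] [Module T N] {φ : Γ(X, X.basicOpen f) →+* T} {D D' : Γ(X, X.basicOpen f) → N}
    (h : IsDerivationAlong φ D) (h' : IsDerivationAlong φ D')
    (e : ∀ s : Γ(X, W), D (X.presheaf.map (homOfLE (X.basicOpen_le f)).op s) =
      D' (X.presheaf.map (homOfLE (X.basicOpen_le f)).op s)) : D = D' := by
  have := hW.isLocalization_basicOpen f
  exact eq_of_isLocalization (R := Γ(X, W)) (.powers f) h h' e

lemma exists_basicOpen (hW : IsAffineOpen W) (f : Γ(X, W)) {D : Γ(X, W) → Γ(X, W)}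
    (h : IsDerivationAlong (RingHom.id _) D) :
    ∃ D' : Γ(X, X.basicOpen f) → Γ(X, X.basicOpen f), IsDerivationAlong (RingHom.id _) D' ∧
      ∀ s, D' (X.presheaf.map (homOfLE (X.basicOpen_le f)).op s) =
        X.presheaf.map (homOfLE (X.basicOpen_le f)).op (D s) := by
  have := hW.isLocalization_basicOpen f
  exact exists_of_isLocalization (R := Γ(X, W)) (S := Γ(X, X.basicOpen f)) (.powers f)
    (h.postcomp (algebraMap Γ(X, W) Γ(X, X.basicOpen f)))

end IsDerivationAlong

/-! ### Derivations of the structure sheaf, described on stalks -/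

/-- A family of derivations of the stalks of `𝒪_X` at the points of an open set `P`, which is
locally given by sections of `𝒪_X`. -/
structure StalkDerivation (X : Scheme.{u}) (P : X.Opens) where
  /-- The derivation of the stalk at `x`, which is meaningful if `x ∈ P`. -/
  d (x : X) : X.presheaf.stalk x → X.presheaf.stalk x
  isDerivationAlong {x : X} (hx : x ∈ P) : IsDerivationAlong (RingHom.id _) (d x)
  exists_germ_eq {U : X.Opens} (s : Γ(X, U)) {x : X} (hx : x ∈ U) (hxP : x ∈ P) :
    ∃ V ≤ U, x ∈ V ∧ ∃ t : Γ(X, V), ∀ (y : X) (hyU : y ∈ U) (hy : y ∈ V), y ∈ P →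
      d y (X.presheaf.germ U y hyU s) = X.presheaf.germ V y hy t

namespace StalkDerivation

variable {X Y Z : Scheme.{u}} {P : X.Opens} (Δ : StalkDerivation X P)

/-- Two local representatives have the same germs on their overlap, namely the values of `Δ.d`, so
they glue. -/
lemma exists_section {U : X.Opens} (hU : U ≤ P) (s : Γ(X, U)) :
    ∃ t : Γ(X, U), ∀ (x : X) (hx : x ∈ U),
      X.presheaf.germ U x hx t = Δ.d x (X.presheaf.germ U x hx s) := by
  choose V hVU hxV t ht using fun x : U => Δ.exists_germ_eq s x.2 (hU x.2)
  obtain ⟨r, hr, -⟩ := X.sheaf.existsUnique_gluing' V U (fun x => homOfLE (hVU x))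
    (fun x hx => TopologicalSpace.Opens.mem_iSup.mpr ⟨⟨x, hx⟩, hxV _⟩) t (by
      intro x y
      apply TopCat.Presheaf.section_ext X.sheaf
      intro z hz
      refine (X.presheaf.germ_res_apply _ z hz _).trans
        (Eq.trans ?_ (X.presheaf.germ_res_apply _ z hz _).symm)
      exact (ht x z (hVU x hz.1) hz.1 (hU (hVU x hz.1))).symm.trans
        (ht y z (hVU x hz.1) hz.2 (hU (hVU x hz.1))))
  refine ⟨r, fun x hx => ?_⟩
  rw [ht ⟨x, hx⟩ x hx (hxV ⟨x, hx⟩) (hU hx), ← hr ⟨x, hx⟩]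
  exact (X.presheaf.germ_res_apply _ x _ _).symm

/-- The derivation on the sections over an open subset of `P`. -/
noncomputable def app {U : X.Opens} (hU : U ≤ P) (s : Γ(X, U)) : Γ(X, U) :=
  (Δ.exists_section hU s).choose

lemma germ_app {U : X.Opens} (hU : U ≤ P) (s : Γ(X, U)) {x : X} (hx : x ∈ U) :
    X.presheaf.germ U x hx (Δ.app hU s) = Δ.d x (X.presheaf.germ U x hx s) :=
  (Δ.exists_section hU s).choose_spec x hx

lemma app_eq_iff {U : X.Opens} (hU : U ≤ P) (s t : Γ(X, U)) :
    Δ.app hU s = t ↔ ∀ (x : X) (hx : x ∈ U),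
      Δ.d x (X.presheaf.germ U x hx s) = X.presheaf.germ U x hx t := by
  refine ⟨fun h x hx => by rw [← h, germ_app], fun h => ?_⟩
  refine TopCat.Presheaf.section_ext X.sheaf _ _ _ fun x hx => ?_
  exact (Δ.germ_app hU s hx).trans (h x hx)

lemma app_isDerivationAlong {U : X.Opens} (hU : U ≤ P) :
    IsDerivationAlong (RingHom.id _) (Δ.app hU) where
  map_add a b := by
    rw [app_eq_iff]
    intro x hx
    rw [map_add, map_add, (Δ.isDerivationAlong (hU hx)).map_add, germ_app, germ_app]
  leibniz a b := by
    rw [app_eq_iff]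
    intro x hx
    simp only [smul_eq_mul, RingHom.id_apply, map_add, map_mul,
      (Δ.isDerivationAlong (hU hx)).leibniz, germ_app]

lemma app_map {U V : X.Opens} (hU : U ≤ P) (i : V ⟶ U) (s : Γ(X, U)) :
    Δ.app (i.le.trans hU) (X.presheaf.map i.op s) = X.presheaf.map i.op (Δ.app hU s) := by
  rw [app_eq_iff]
  intro x hx
  rw [TopCat.Presheaf.germ_res_apply, TopCat.Presheaf.germ_res_apply, germ_app]

/-- A compatible family of derivations on sections induces derivations on the stalks. -/
lemma exists_of_sections (D : ∀ U : X.Opens, Γ(X, U) → Γ(X, U))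
    (hD : ∀ U ≤ P, IsDerivationAlong (RingHom.id _) (D U))
    (hD' : ∀ (U V : X.Opens) (_ : U ≤ P) (i : V ⟶ U) (s : Γ(X, U)),
      D V (X.presheaf.map i.op s) = X.presheaf.map i.op (D U s)) :
    ∃ Δ : StalkDerivation X P, ∀ U ≤ P, ∀ (x : X) (hx : x ∈ U) (s : Γ(X, U)),
      Δ.d x (X.presheaf.germ U x hx s) = X.presheaf.germ U x hx (D U s) := by
  -- The germ of `D U s` depends only on the germ of `s`. Outside `P` the condition is vacuous and
  -- `0` serves as value.
  have key (x : X) (b : X.presheaf.stalk x) : ∃ c : X.presheaf.stalk x,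
      ∀ U ≤ P, ∀ (hx : x ∈ U) (s : Γ(X, U)), X.presheaf.germ U x hx s = b →
        X.presheaf.germ U x hx (D U s) = c := by
    by_cases hxP : x ∈ P
    · obtain ⟨U, hU, hx, s, hs⟩ := X.presheaf.exists_le_germ_eq b hxP
      refine ⟨X.presheaf.germ U x hx (D U s), fun V hV hxV t ht => ?_⟩
      obtain ⟨W, hxW, iV, iU, h⟩ := X.presheaf.germ_eq x hxV hx t s (ht.trans hs.symm)
      refine X.presheaf.germ_ext W hxW iV iU ?_
      rw [← hD' _ _ hV, ← hD' _ _ hU, h]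
    · exact ⟨0, fun U hU hx => (hxP (hU hx)).elim⟩
  choose d hd using key
  have hd' {U} (hU : U ≤ P) (x : X) (hx : x ∈ U) (s : Γ(X, U)) :
      d x (X.presheaf.germ U x hx s) = X.presheaf.germ U x hx (D U s) :=
    (hd x _ U hU hx s rfl).symm
  have hpair {x : X} (hx : x ∈ P) (a b : X.presheaf.stalk x) :
      ∃ (U : X.Opens) (_ : U ≤ P) (hxU : x ∈ U) (s t : Γ(X, U)),
        X.presheaf.germ U x hxU s = a ∧ X.presheaf.germ U x hxU t = b := by
    obtain ⟨U, hU, hxU, s, rfl⟩ := X.presheaf.exists_le_germ_eq a hx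
    obtain ⟨V, hV, hxV, t, rfl⟩ := X.presheaf.exists_le_germ_eq b hxU
    exact ⟨V, hV.trans hU, hxV, X.presheaf.map (homOfLE hV).op s, t,
      X.presheaf.germ_res_apply _ _ _ _, rfl⟩
  refine ⟨⟨d, fun {x} hx => ⟨fun a b => ?_, fun a b => ?_⟩, fun {U} s {x} hx hxP => ?_⟩,
    fun U hU => hd' hU⟩
  · obtain ⟨U, hU, hxU, s, t, rfl, rfl⟩ := hpair hx a b
    rw [← map_add, hd' hU, hd' hU, hd' hU, (hD U hU).map_add, map_add]
  · obtain ⟨U, hU, hxU, s, t, rfl, rfl⟩ := hpair hx a b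
    rw [← map_mul, hd' hU, hd' hU, hd' hU, (hD U hU).leibniz]
    simp
  · refine ⟨U ⊓ P, inf_le_left, ⟨hx, hxP⟩,
      D (U ⊓ P) (X.presheaf.map (homOfLE inf_le_left).op s), fun y hyU hy _ => ?_⟩
    rw [← hd' inf_le_right y hy, TopCat.Presheaf.germ_res_apply]

/-- Transport of derivations along a morphism which induces isomorphisms on stalks. -/
lemma exists_of_bijective_stalkMap (j : Z ⟶ X) (hj : ∀ z, Function.Bijective (j.stalkMap z)) :
    ∃ Δ' : StalkDerivation Z (j ⁻¹ᵁ P), ∀ z b, Δ'.d z (j.stalkMap z b) =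
      j.stalkMap z (Δ.d (j z) b) := by
  choose inv hinv using fun z => (hj z).surjective
  have hinv' (z : Z) (b) : inv z (j.stalkMap z b) = b := (hj z).injective (hinv z _)
  refine ⟨⟨fun z b => j.stalkMap z (Δ.d (j z) (inv z b)),
    fun {z} hz => ⟨fun a b => ?_, fun a b => ?_⟩, fun {U} s {z} hz hzP => ?_⟩,
    fun z b => by simp only [hinv']⟩
  · obtain ⟨a, rfl⟩ := (hj z).surjective a
    obtain ⟨b, rfl⟩ := (hj z).surjective b
    rw [← map_add, hinv', hinv', hinv', (Δ.isDerivationAlong hz).map_add, map_add]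
  · obtain ⟨a, rfl⟩ := (hj z).surjective a
    obtain ⟨b, rfl⟩ := (hj z).surjective b
    rw [← map_mul, hinv', hinv', hinv', (Δ.isDerivationAlong hz).leibniz]
    simp
  -- The germ of `s` at `z` comes from a section `t` on `X`. The pullback of `t` agrees with `s`
  -- near `z`, so the pullback of `Δ.app hW t` represents the transported derivation there.
  · obtain ⟨W, hW, hzW, t, ht⟩ := X.presheaf.exists_le_germ_eq
      (inv z (Z.presheaf.germ U z hz s)) (show j z ∈ P from hzP)
    have h1 : Z.presheaf.germ (j ⁻¹ᵁ W) z hzW (j.app W t) = Z.presheaf.germ U z hz s := by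
      rw [← Scheme.Hom.germ_stalkMap_apply, ht, hinv]
    obtain ⟨V, hzV, iW, iU, h⟩ := Z.presheaf.germ_eq z hzW hz _ _ h1
    refine ⟨V, iU.le, hzV, Z.presheaf.map iW.op (j.app W (Δ.app hW t)), fun y hyU hyV _ => ?_⟩
    have hyW : j y ∈ W := iW.le hyV
    rw [TopCat.Presheaf.germ_res_apply, ← Scheme.Hom.germ_stalkMap_apply j W y hyW,
      germ_app]
    congr 2
    apply (hj y).injective
    rw [hinv, Scheme.Hom.germ_stalkMap_apply j W y hyW,
      ← Z.presheaf.germ_res_apply iU y hyV, ← Z.presheaf.germ_res_apply iW y hyV, h]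

/-- A derivation on `X` induces a derivation on `Y` if `g : X ⟶ Y` satisfies `𝒪_Y ≅ g_*𝒪_X`. -/
lemma exists_of_bijective_app (g : X ⟶ Y) (hg : ∀ U : Y.Opens, Function.Bijective (g.app U))
    {Q : Y.Opens} (Δ : StalkDerivation X (g ⁻¹ᵁ Q)) :
    ∃ Δ' : StalkDerivation Y Q, ∀ {U : Y.Opens} (_ : U ≤ Q) (s t : Γ(Y, U)),
      (∀ (x : X) (hx : x ∈ g ⁻¹ᵁ U), Δ.d x (X.presheaf.germ (g ⁻¹ᵁ U) x hx (g.app U s)) =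
        X.presheaf.germ (g ⁻¹ᵁ U) x hx (g.app U t)) →
      ∀ (y : Y) (hy : y ∈ U), Δ'.d y (Y.presheaf.germ U y hy s) = Y.presheaf.germ U y hy t := by
  -- Over opens not contained in `Q` the value is `0`, which is never used.
  have key (U : Y.Opens) (s : Γ(Y, U)) : ∃ t : Γ(Y, U), ∀ hU : U ≤ Q,
      g.app U t = Δ.app (g.preimage_mono hU) (g.app U s) := by
    by_cases hU : U ≤ Q
    · obtain ⟨t, ht⟩ := (hg U).surjective (Δ.app (g.preimage_mono hU) (g.app U s))
      exact ⟨t, fun _ => ht⟩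
    · exact ⟨0, fun h => (hU h).elim⟩
  choose D hD using key
  have hder (U) (hU : U ≤ Q) : IsDerivationAlong (RingHom.id _) (D U) := by
    constructor <;> intro a b <;> apply (hg U).injective
    · simp only [map_add, hD _ _ hU, (Δ.app_isDerivationAlong _).map_add]
    · simp only [map_mul, smul_eq_mul, RingHom.id_apply, map_add, hD _ _ hU,
        (Δ.app_isDerivationAlong _).leibniz]
  obtain ⟨Δ', h⟩ := exists_of_sections D hder (fun U V hU i s => by
    apply (hg V).injective
    have nat (a : Γ(Y, U)) : g.app V (Y.presheaf.map i.op a) =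
        X.presheaf.map ((TopologicalSpace.Opens.map g.base).map i).op (g.app U a) :=
      congr($(g.naturality i.op) a)
    rw [hD _ _ (i.le.trans hU), nat, nat, hD _ _ hU]
    exact Δ.app_map (g.preimage_mono hU) ((TopologicalSpace.Opens.map g.base).map i) _)
  refine ⟨Δ', fun {U} hU s t hst y hy => ?_⟩
  rw [h U hU]
  congr 1
  apply (hg U).injective
  rw [hD U s hU, app_eq_iff]
  exact hst

/-- The derivation `δ` of `Γ(C, V)` lifts along `h : X ⟶ C` to a derivation of `𝒪_X` over the
preimage of `V`. -/
def Lifts {X C : Scheme.{u}} (h : X ⟶ C) (V : C.Opens) (δ : Γ(C, V) → Γ(C, V)) : Prop :=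
  ∃ Δ : StalkDerivation X (h ⁻¹ᵁ V), ∀ (x : X) (hx : x ∈ h ⁻¹ᵁ V) (a : Γ(C, V)),
    Δ.d x (X.presheaf.germ (h ⁻¹ᵁ V) x hx (h.app V a)) =
      X.presheaf.germ (h ⁻¹ᵁ V) x hx (h.app V (δ a))

lemma Lifts.of_comp {C : Scheme.{u}} {g : X ⟶ Y} (hg : ∀ U : Y.Opens, Function.Bijective (g.app U))
    {π : Y ⟶ C} {V : C.Opens} {δ : Γ(C, V) → Γ(C, V)} (h : Lifts (g ≫ π) V δ) : Lifts π V δ := by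
  obtain ⟨Δ, hΔ⟩ := h
  obtain ⟨Δ', hΔ'⟩ := exists_of_bijective_app g hg (Q := π ⁻¹ᵁ V) Δ
  exact ⟨Δ', fun y hy a => hΔ' le_rfl _ _ (fun x hx => hΔ x hx a) y hy⟩

lemma Lifts.comp {C : Scheme.{u}} {j : Z ⟶ X} (hj : ∀ z, Function.Bijective (j.stalkMap z))
    {π : X ⟶ C} {V : C.Opens} {δ : Γ(C, V) → Γ(C, V)} (h : Lifts π V δ) : Lifts (j ≫ π) V δ := by
  obtain ⟨Δ, hΔ⟩ := h
  obtain ⟨Δ', hΔ'⟩ := Δ.exists_of_bijective_stalkMap j hj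
  refine ⟨Δ', fun z hz a => ?_⟩
  have key (b : Γ(C, V)) : Z.presheaf.germ ((j ≫ π) ⁻¹ᵁ V) z hz ((j ≫ π).app V b) =
      j.stalkMap z (X.presheaf.germ (π ⁻¹ᵁ V) (j z) hz (π.app V b)) := by
    rw [Scheme.Hom.germ_stalkMap_apply j _ z hz, Scheme.Hom.comp_app]
    rfl
  rw [key, key, hΔ']
  exact congrArg (j.stalkMap z) (hΔ (j z) hz a)

end StalkDerivation

/-! ### Lifting a vector field to a product -/

namespace StalkDerivation

variable {X X₀ C S : Scheme.{u}} {q : X ⟶ X₀} {π : X ⟶ C} {x₀ : X₀ ⟶ S} {c : C ⟶ S}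

/-- On a chart of `X₀ ×_S C`, a derivation of the second factor extends uniquely to a derivation
which vanishes on the first factor. -/
lemma exists_chart (H : IsPullback q π x₀ c) {U : S.Opens} (hU : IsAffineOpen U) {V : C.Opens}
    (hV : IsAffineOpen V) (e : V ≤ c ⁻¹ᵁ U) {δ : Γ(C, V) → Γ(C, V)}
    (hδ : IsDerivationAlong (RingHom.id _) δ) (hδ0 : ∀ a, δ (c.appLE U V e a) = 0)
    {x : X} (hx : x ∈ π ⁻¹ᵁ V) :
    ∃ (W₀ : X₀.Opens) (W : X.Opens) (h₀ : W ≤ q ⁻¹ᵁ W₀) (h : W ≤ π ⁻¹ᵁ V)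
      (D : Γ(X, W) → Γ(X, W)), IsAffineOpen W₀ ∧ IsAffineOpen W ∧ x ∈ W ∧
      IsDerivationAlong (RingHom.id _) D ∧ (∀ a, D (q.appLE W₀ W h₀ a) = 0) ∧
      (∀ a, D (π.appLE V W h a) = π.appLE V W h (δ a)) ∧
      ∀ {T : Type u} [CommRing T] (φ : Γ(X, W) →+* T) (D₁ D₂ : Γ(X, W) → T),
        IsDerivationAlong φ D₁ → IsDerivationAlong φ D₂ →
        (∀ a, D₁ (q.appLE W₀ W h₀ a) = D₂ (q.appLE W₀ W h₀ a)) →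
        (∀ a, D₁ (π.appLE V W h a) = D₂ (π.appLE V W h a)) → D₁ = D₂ := by
  have hxU : q x ∈ x₀ ⁻¹ᵁ U := by
    have : x ∈ (π ≫ c) ⁻¹ᵁ U := e hx
    rwa [← H.w] at this
  obtain ⟨_, ⟨W₀, hW₀, rfl⟩, hxW₀, hW₀U⟩ :=
    X₀.isBasis_affineOpens.exists_subset_of_mem_open hxU (x₀ ⁻¹ᵁ U).isOpen
  have hW₀ : IsAffineOpen W₀ := hW₀
  have hW₀U : W₀ ≤ x₀ ⁻¹ᵁ U := hW₀U
  obtain ⟨W, hW⟩ : ∃ W, W = q ⁻¹ᵁ W₀ ⊓ π ⁻¹ᵁ V := ⟨_, rfl⟩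
  have hWaff : IsAffineOpen W := by
    have : IsAffine _ := hU
    have : IsAffine _ := hV
    have : IsAffine _ := hW₀
    exact .of_isIso (Scheme.Hom.isPullback_resLE H e hW₀U hW).isoPullback.hom
  have h₀ : W ≤ q ⁻¹ᵁ W₀ := hW.trans_le inf_le_left
  have h : W ≤ π ⁻¹ᵁ V := hW.trans_le inf_le_right
  have hpo := (isIso_pushoutSection_iff H e hW₀U hW).mp
    (isIso_pushoutSection_of_isAffineOpen H e hW₀U hW hU hV hW₀)
  algebraize [(x₀.appLE U W₀ hW₀U).hom, (c.appLE U V e).hom, (q.appLE W₀ W h₀).hom,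
    (π.appLE V W h).hom, ((q.appLE W₀ W h₀).hom.comp (x₀.appLE U W₀ hW₀U).hom)]
  have : IsScalarTower Γ(S, U) Γ(C, V) Γ(X, W) :=
    .of_algebraMap_eq' congr($(hpo.w).hom)
  have hp : Algebra.IsPushout Γ(S, U) Γ(X₀, W₀) Γ(C, V) Γ(X, W) :=
    CommRingCat.isPushout_iff_isPushout.mp hpo
  obtain ⟨D, hD, hD0, hD1⟩ := IsDerivationAlong.exists_of_isPushout (k := Γ(S, U))
    (A := Γ(X₀, W₀)) (B := Γ(C, V)) (R := Γ(X, W)) hδ hδ0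
  exact ⟨W₀, W, h₀, h, D, hW₀, hWaff, hW ▸ ⟨hxW₀, hx⟩, hD, hD0, hD1,
    fun φ D₁ D₂ h₁ h₂ => IsDerivationAlong.eq_of_isPushout (k := Γ(S, U))
      (A := Γ(X₀, W₀)) (B := Γ(C, V)) (R := Γ(X, W)) h₁ h₂⟩

lemma germ_appLE {X Y : Scheme.{u}} (f : X ⟶ Y) {V : Y.Opens} {W : X.Opens} (h : W ≤ f ⁻¹ᵁ V)
    {x : X} (hx : x ∈ W) (a : Γ(Y, V)) :
    X.presheaf.germ W x hx (f.appLE V W h a) = f.stalkMap x (Y.presheaf.germ V (f x) (h hx) a) :=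
  (X.presheaf.germ_res_apply (homOfLE h) x hx _).trans
    (Scheme.Hom.germ_stalkMap_apply f V x (h hx) a).symm

/-- On a product `X = X₀ ×_S C`, a derivation of `𝒪_C` over an affine open `V` extends to a
derivation of `𝒪_X` over the preimage of `V`. -/
lemma Lifts.of_isPullback (H : IsPullback q π x₀ c) {U : S.Opens} (hU : IsAffineOpen U)
    {V : C.Opens} (hV : IsAffineOpen V) (e : V ≤ c ⁻¹ᵁ U) {δ : Γ(C, V) → Γ(C, V)}
    (hδ : IsDerivationAlong (RingHom.id _) δ) (hδ0 : ∀ a, δ (c.appLE U V e a) = 0) :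
    Lifts π V δ := by
  -- These conditions pin the derivation down on each chart. Hence derivations chosen independently
  -- at the points agree with the chart derivations, and no gluing of charts is needed.
  let Good (x : X) (hx : x ∈ π ⁻¹ᵁ V) (d : X.presheaf.stalk x → X.presheaf.stalk x) : Prop :=
    IsDerivationAlong (RingHom.id _) d ∧ (∀ b, d (q.stalkMap x b) = 0) ∧
      ∀ a, d (π.stalkMap x (C.presheaf.germ V (π x) hx a)) =
        π.stalkMap x (C.presheaf.germ V (π x) hx (δ a))
  have ex (x : X) (hx : x ∈ π ⁻¹ᵁ V) : ∃ d, Good x hx d := by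
    obtain ⟨W₀, W, h₀, h, D, hW₀, hW, hxW, hD, hD0, hD1, -⟩ := exists_chart H hU hV e hδ hδ0 hx
    obtain ⟨d, hd, hd'⟩ := hD.exists_germ hW hxW
    refine ⟨d, hd, fun b => ?_, fun a => ?_⟩
    -- Vanishing on the stalk of `X₀` only has to be checked on germs of sections over `W₀`.
    · refine congrFun (IsDerivationAlong.eq_of_germ hW₀ (h₀ hxW) (D := fun b => d (q.stalkMap x b))
        (D' := fun _ => 0) (hd.comp (q.stalkMap x).hom) ⟨by simp, by simp⟩ fun s => ?_) b
      rw [← germ_appLE q h₀ hxW, hd', hD0, map_zero]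
    · rw [← germ_appLE π h hxW, hd', hD1, germ_appLE]
  choose! d hd using ex
  refine ⟨⟨d, fun hx => (hd _ hx).1, fun {O} s {x} hxO hx => ?_⟩, fun x hx a => ?_⟩
  · obtain ⟨W₀, W, h₀, h, D, hW₀, hW, hxW, hD, hD0, hD1, huniq⟩ :=
      exists_chart H hU hV e hδ hδ0 hx
    -- The section `s` lives on `O`, which need not contain the chart `W`; a basic open of `W`
    -- inside `O` inherits the chart derivation by localization.
    obtain ⟨f, hf, hxf⟩ := hW.exists_basicOpen_le ⟨x, hxO⟩ hxW
    obtain ⟨D', hD', hD'W⟩ := hD.exists_basicOpen hW f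
    have hfW := X.basicOpen_le f
    refine ⟨X.basicOpen f, hf, hxf, D' (X.presheaf.map (homOfLE hf).op s), fun y hyO hy hyV => ?_⟩
    obtain ⟨h1, h2, h3⟩ := hd y hyV
    rw [← X.presheaf.germ_res_apply (homOfLE hf) y hy]
    -- Both sides are derivations into the stalk at `y`. Uniqueness under localization reduces the
    -- comparison to `W`, and uniqueness on the chart reduces it to functions from the two factors.
    refine congrFun (IsDerivationAlong.eq_of_basicOpen hW f
      (φ := (X.presheaf.germ (X.basicOpen f) y hy).hom)
      (D := fun t => d y (X.presheaf.germ (X.basicOpen f) y hy t))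
      (D' := fun t => X.presheaf.germ (X.basicOpen f) y hy (D' t))
      (h1.comp (X.presheaf.germ (X.basicOpen f) y hy).hom)
      (hD'.postcomp (X.presheaf.germ (X.basicOpen f) y hy).hom) fun t => ?_) _
    rw [hD'W, TopCat.Presheaf.germ_res_apply, TopCat.Presheaf.germ_res_apply]
    refine congrFun (huniq (X.presheaf.germ W y (hfW hy)).hom
      (fun t => d y (X.presheaf.germ W y (hfW hy) t))
      (fun t => X.presheaf.germ W y (hfW hy) (D t))
      (h1.comp (X.presheaf.germ W y (hfW hy)).hom)
      (hD.postcomp (X.presheaf.germ W y (hfW hy)).hom) (fun a => ?_) fun a => ?_) t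
    · rw [germ_appLE, h2, hD0, map_zero]
    · rw [germ_appLE, h3, hD1, germ_appLE]
  · have hx' : π x ∈ V := hx
    have h := (hd x hx).2.2 a
    rwa [Scheme.Hom.germ_stalkMap_apply π V x hx', Scheme.Hom.germ_stalkMap_apply π V x hx'] at h

end StalkDerivation

/-! ### A retraction splits the sequence of differentials -/

namespace SchemeDiff

variable {X S T : Scheme.{u}}

/-- The differentials `d x` determine a map out of `Ω_{X/S}`, and they all lie in the image of
`Ω_{X/T}`. -/
lemma omegaToRel_cancel {p : X ⟶ S} {r : S ⟶ T} {M : X.Modules} {a b : Omega p ⟶ M}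
    (h : omegaToRel p r ≫ a = omegaToRel p r ≫ b) : a = b := by
  refine Omega_hom_ext fun U x => ?_
  have key (c : Omega p ⟶ M) : c.app U ((univDer p).d (X := .op U) x) =
      (omegaToRel p r ≫ c).app U ((univDer (p ≫ r)).d (X := .op U) x) :=
    congrArg (c.app U) (desc_app_univDer ((univDer p).restrictBase r) U x).symm
  rw [key, key, h]

/-- The hypothesis says that the `𝒪_T`-derivation attached to `φ` kills functions from `S`, so it is
already an `𝒪_S`-derivation. -/
lemma exists_omegaToRel_comp_eq {p : X ⟶ S} {r : S ⟶ T} {M : X.Modules} (φ : Omega (p ≫ r) ⟶ M)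
    (h : ∀ (V : S.Opens) (x : Γ(S, V)),
      φ.app (p ⁻¹ᵁ V) ((univDer (p ≫ r)).d (X := .op (p ⁻¹ᵁ V)) (p.app V x)) = 0) :
    ∃ s : Omega p ⟶ M, omegaToRel p r ≫ s = φ := by
  let D : Der p M :=
    { d := (homEquivDer (p ≫ r) M φ).d
      d_mul := (homEquivDer (p ≫ r) M φ).d_mul
      d_map := (homEquivDer (p ≫ r) M φ).d_map
      d_app := fun {V} a => by
        have := h V.unop a
        rw [hom_app_univDer] at this
        exact this }
  refine ⟨desc D, Omega_hom_ext fun U x => ?_⟩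
  rw [hom_app_univDer φ]
  refine (congrArg ((desc D).app U)
    (desc_app_univDer ((univDer p).restrictBase r) U x)).trans ?_
  exact desc_app_univDer D U x

/-- The sequence of differentials splits if `p^*Ω_{S/T} ⟶ Ω_{X/T}` has a retraction. -/
lemma nonempty_splitting_diffSequence (p : X ⟶ S) (r : S ⟶ T)
    (ρ : Omega (p ≫ r) ⟶ (Scheme.Modules.pullback p).obj (Omega r))
    (hρ : ∀ (V : S.Opens) (x : Γ(S, V)),
      ρ.app (p ⁻¹ᵁ V) ((univDer (p ≫ r)).d (X := .op (p ⁻¹ᵁ V)) (p.app V x)) =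
        ((Scheme.Modules.pullbackPushforwardAdjunction p).unit.app (Omega r)).app V
          ((univDer r).d (X := .op V) x)) :
    Nonempty (diffSequence p r).Splitting := by
  have hto (V : S.Opens) (x : Γ(S, V)) :
      (omegaToPushforward p r).app V ((univDer r).d (X := .op V) x) =
        (univDer (p ≫ r)).d (X := .op (p ⁻¹ᵁ V)) (p.app V x) :=
    desc_app_univDer ((univDer (p ≫ r)).push p r) V x
  have hadj : (Scheme.Modules.pullbackPushforwardAdjunction p).homEquiv _ _
      (pullbackOmegaTo p r) = omegaToPushforward p r := Equiv.apply_symm_apply _ _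
  have hf : pullbackOmegaTo p r ≫ ρ = 𝟙 _ := by
    apply ((Scheme.Modules.pullbackPushforwardAdjunction p).homEquiv _ _).injective
    rw [Adjunction.homEquiv_naturality_right, hadj, Adjunction.homEquiv_id]
    refine Omega_hom_ext fun V x => ?_
    rw [← hρ, ← hto]
    rfl
  -- On `d(p^♯ x)` the composite of `ρ` with `pullbackOmegaTo` is the identity, so the complementary
  -- endomorphism vanishes there and descends.
  obtain ⟨s, hs⟩ := exists_omegaToRel_comp_eq (𝟙 _ - ρ ≫ pullbackOmegaTo p r) (fun V x => by
    rw [Scheme.Modules.Hom.sub_app]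
    refine sub_eq_zero.mpr ?_
    refine Eq.trans ?_ (congrArg ((pullbackOmegaTo p r).app (p ⁻¹ᵁ V)) (hρ V x)).symm
    rw [Adjunction.homEquiv_unit] at hadj
    rw [← hto, ← hadj]
    rfl)
  refine ⟨⟨ρ, s, hf, omegaToRel_cancel (r := r) ?_, ?_⟩⟩
  · change omegaToRel p r ≫ s ≫ omegaToRel p r = omegaToRel p r ≫ 𝟙 _
    rw [← Category.assoc, hs, Preadditive.sub_comp, Category.assoc, pullbackOmegaTo_comp]
    simp
  · change ρ ≫ pullbackOmegaTo p r + omegaToRel p r ≫ s = 𝟙 _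
    rw [hs]
    abel

lemma univDer_isDerivationAlong (f : X ⟶ S) (U : X.Opens) :
    IsDerivationAlong (N := Γ(Omega f, U)) (RingHom.id Γ(X, U))
      (fun x => (univDer f).d (X := .op U) x) where
  map_add a b := _root_.map_add (univDer f).d a b
  leibniz a b := (univDer f).d_mul (X := .op U) a b

end SchemeDiff

/-! ### Vanishing of derivations, and local rings of flat preimmersions -/

lemma AlgebraicGeometry.Scheme.Modules.eq_zero_of_locally {X : Scheme.{u}} (N : X.Modules)
    {U : X.Opens} (s : Γ(N, U))
    (h : ∀ x ∈ U, ∃ (V : X.Opens) (i : V ⟶ U), x ∈ V ∧ N.presheaf.map i.op s = 0) : s = 0 := by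
  choose V i hV hs using fun x : U => h x.1 x.2
  refine TopCat.Sheaf.eq_of_locally_eq' ⟨N.presheaf, N.isSheaf⟩ V U i
    (fun x hx => TopologicalSpace.Opens.mem_iSup.mpr ⟨⟨x, hx⟩, hV _⟩) s 0 fun x => ?_
  exact (hs x).trans (map_zero (N.presheaf.map (i x).op).hom).symm

/-- A compatible family of derivations which vanishes on the sections of `C` over an affine open
subset vanishes, if all local rings of `S` are quotients of local rings of `C` at points of this
subset. -/
lemma eq_zero_of_surjectiveOnStalks {Z S C : Scheme.{u}} (p : Z ⟶ S) (j : S ⟶ C)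
    (hj : ∀ y, Function.Surjective (j.stalkMap y)) {V : C.Opens} (hV : IsAffineOpen V)
    (hjV : ∀ y, j y ∈ V) (N : Z.Modules) (E : ∀ O : S.Opens, Γ(S, O) → Γ(N, p ⁻¹ᵁ O))
    (hE : ∀ O, IsDerivationAlong (p.app O).hom (E O))
    (hres : ∀ (O O' : S.Opens) (i : O' ⟶ O) (a : Γ(S, O)), E O' (S.presheaf.map i.op a) =
      N.presheaf.map ((TopologicalSpace.Opens.map p.base).map i).op (E O a))
    (h0 : ∀ a : Γ(C, V), E (j ⁻¹ᵁ V) (j.app V a) = 0) (O : S.Opens) (a : Γ(S, O)) : E O a = 0 := by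
  refine N.eq_zero_of_locally _ fun z hz => ?_
  obtain ⟨y, hy⟩ : ∃ y, y = p z := ⟨_, rfl⟩
  have hyO : y ∈ O := hy ▸ hz
  have hyV : y ∈ j ⁻¹ᵁ V := hjV y
  -- The germ of `a` lifts to the local ring of `C`, where it is a fraction `b / f` of functions on
  -- `V`.
  obtain ⟨c, hc⟩ := hj y (S.presheaf.germ O y hyO a)
  obtain ⟨f, b, hf, hfb⟩ : ∃ f b : Γ(C, V), IsUnit (C.presheaf.germ V (j y) (hjV y) f) ∧
      c * C.presheaf.germ V (j y) (hjV y) f = C.presheaf.germ V (j y) (hjV y) b := by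
    let := C.presheaf.algebra_section_stalk ⟨j y, hjV y⟩
    have := hV.isLocalization_stalk ⟨j y, hjV y⟩
    obtain ⟨⟨b, f⟩, h⟩ := IsLocalization.surj (R := Γ(C, V)) (S := C.presheaf.stalk (j y))
      (hV.primeIdealOf ⟨j y, hjV y⟩).asIdeal.primeCompl c
    exact ⟨f, b, IsLocalization.map_units (R := Γ(C, V)) (C.presheaf.stalk (j y)) f, h⟩
  have hg (a) := Scheme.Hom.germ_stalkMap_apply j V y (hjV y) a
  have hyf : y ∈ S.basicOpen (j.app V f) := by
    rw [S.mem_basicOpen _ _ hyV, ← hg]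
    exact hf.map (j.stalkMap y).hom
  have hab : S.presheaf.germ O y hyO a * S.presheaf.germ _ y hyV (j.app V f) =
      S.presheaf.germ _ y hyV (j.app V b) := by
    rw [← hc, ← hg, ← hg, ← hfb, map_mul]
  -- Shrinking makes `f` invertible and turns `a * f = b` from an equation of germs into one of
  -- sections.
  let O₁ : S.Opens := O ⊓ S.basicOpen (j.app V f)
  have hO₁V : O₁ ≤ j ⁻¹ᵁ V := inf_le_right.trans (S.basicOpen_le _)
  have hO₁O : O₁ ≤ O := inf_le_left
  have hyO₁ : y ∈ O₁ := ⟨hyO, hyf⟩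
  obtain ⟨O₂, hyO₂, i, i', h⟩ := S.presheaf.germ_eq y hyO₁ hyO₁
    (S.presheaf.map (homOfLE hO₁O).op a * S.presheaf.map (homOfLE hO₁V).op (j.app V f))
    (S.presheaf.map (homOfLE hO₁V).op (j.app V b)) (by
      rw [map_mul, TopCat.Presheaf.germ_res_apply, TopCat.Presheaf.germ_res_apply,
        TopCat.Presheaf.germ_res_apply]
      exact hab)
  obtain ⟨iO, hiO⟩ : ∃ k : O₂ ⟶ O, k = i ≫ homOfLE hO₁O := ⟨_, rfl⟩
  obtain ⟨iV, hiV⟩ : ∃ k : O₂ ⟶ j ⁻¹ᵁ V, k = i ≫ homOfLE hO₁V := ⟨_, rfl⟩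
  have h' : S.presheaf.map iO.op a * S.presheaf.map iV.op (j.app V f) =
      S.presheaf.map iV.op (j.app V b) := by
    obtain rfl : i = i' := Subsingleton.elim _ _
    rw [map_mul] at h
    simp only [hiO, hiV, op_comp, Functor.map_comp, ConcreteCategory.comp_apply]
    exact h
  have hunit : IsUnit (S.presheaf.map iV.op (j.app V f)) := by
    have h1 := RingedSpace.isUnit_res_basicOpen S.toRingedSpace (j.app V f)
    have h2 := h1.map (S.presheaf.map (i ≫ homOfLE (inf_le_right :
      O₁ ≤ S.basicOpen (j.app V f))).op).hom
    refine (congrArg IsUnit ?_).mp h2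
    exact (ConcreteCategory.comp_apply _ _ _).symm.trans
      (congr($((S.presheaf.map_comp _ _).symm) (j.app V f)))
  have hEV (t : Γ(C, V)) : E O₂ (S.presheaf.map iV.op (j.app V t)) = 0 := by
    rw [hres, h0, map_zero]
  -- Since `E` kills `f` and `b`, the Leibniz rule for `a * f = b` leaves `f • E a = 0` with `f` a
  -- unit.
  have hl := (hE O₂).leibniz (S.presheaf.map iO.op a) (S.presheaf.map iV.op (j.app V f))
  rw [h', hEV, hEV, smul_zero, zero_add] at hl
  refine ⟨p ⁻¹ᵁ O₂, (TopologicalSpace.Opens.map p.base).map iO, (hy ▸ hyO₂ : p z ∈ O₂), ?_⟩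
  rw [← hres]
  exact ((hunit.map (p.app O₂).hom).smul_eq_zero.mp hl.symm)

/-- A flat local homomorphism is faithfully flat, hence injective; surjectivity is part of being a
preimmersion. -/
lemma AlgebraicGeometry.Scheme.Hom.bijective_stalkMap_of_isPreimmersion_of_flat
    {X Y : Scheme.{u}} (f : X ⟶ Y)
    [IsPreimmersion f] [Flat f] (x : X) : Function.Bijective (f.stalkMap x) := by
  refine ⟨?_, f.stalkMap_surjective x⟩
  algebraize [(f.stalkMap x).hom]
  have : Module.FaithfullyFlat (Y.presheaf.stalk (f x)) (X.presheaf.stalk x) :=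
    @Module.FaithfullyFlat.of_flat_of_isLocalHom _ _ _ _ _ _ _
      (Flat.stalkMap f x) (f.toLRSHom.prop x)
  exact ‹RingHom.FaithfullyFlat _›.injective

instance AlgebraicGeometry.Scheme.flat_fromSpecStalk (X : Scheme.{u}) (x : X) :
    Flat (X.fromSpecStalk x) := by
  obtain ⟨_, ⟨U, hU, rfl⟩, hxU, -⟩ :=
    X.isBasis_affineOpens.exists_subset_of_mem_open (Set.mem_univ x) isOpen_univ
  have hU : IsAffineOpen U := hU
  have hxU : x ∈ U := hxU
  rw [← hU.fromSpecStalk_eq_fromSpecStalk hxU]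
  have : Flat (Spec.map (X.presheaf.germ U x hxU)) := by
    rw [Flat.SpecMap_iff]
    let := X.presheaf.algebra_section_stalk ⟨x, hxU⟩
    have := hU.isLocalization_stalk ⟨x, hxU⟩
    exact IsLocalization.flat (R := Γ(X, U)) (X.presheaf.stalk x)
      (hU.primeIdealOf ⟨x, hxU⟩).asIdeal.primeCompl
  delta IsAffineOpen.fromSpecStalk
  infer_instance

/-! ### Constructing the retraction from a lifted vector field -/

namespace SchemeDiff

lemma univDer_app_appLE {S C T : Scheme.{u}} (j : S ⟶ C) (c : C ⟶ T) {W : T.Opens} {V : C.Opens}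
    (e : V ≤ c ⁻¹ᵁ W) (a : Γ(T, W)) :
    (univDer (j ≫ c)).d (X := .op (j ⁻¹ᵁ V)) (j.app V (c.appLE W V e a)) = 0 := by
  have h : j.app V (c.appLE W V e a) =
      S.presheaf.map (homOfLE (j.preimage_mono e)).op ((j ≫ c).app W a) :=
    congr($(j.naturality (homOfLE e).op) (c.app W a))
  rw [h]
  refine ((univDer (j ≫ c)).d_map _ _).trans ?_
  refine Eq.trans (congrArg (((Scheme.Modules.toPresheafOfModules S).obj (Omega (j ≫ c))).map
    (homOfLE (j.preimage_mono e)).op) ((univDer (j ≫ c)).d_app a)) ?_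
  exact map_zero _

/-- The retraction sends `dy` to `Δ y • p^*w`; by `hw` it sends the differential of a function `a`
on `V` to `δ a • p^*w = p^*(da)`, as required. -/
lemma nonempty_splitting_of_lifts {Z S T C : Scheme.{u}} (p : Z ⟶ S) (r : S ⟶ T) (j : S ⟶ C)
    (hj : ∀ y, Function.Surjective (j.stalkMap y)) {V : C.Opens} (hV : IsAffineOpen V)
    (hjV : ∀ y, j y ∈ V) {δ : Γ(C, V) → Γ(C, V)} (hl : StalkDerivation.Lifts (p ≫ j) V δ)
    (w : Γ(Omega r, j ⁻¹ᵁ V))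
    (hw : ∀ a, (univDer r).d (X := .op (j ⁻¹ᵁ V)) (j.app V a) = j.app V (δ a) • w) :
    Nonempty (diffSequence p r).Splitting := by
  obtain ⟨Δ, hΔ⟩ := hl
  have hP (O : Z.Opens) : O ≤ (p ≫ j) ⁻¹ᵁ V := fun z _ => hjV (p z)
  let N : Z.Modules := (Scheme.Modules.pullback p).obj (Omega r)
  let η : Omega r ⟶ (Scheme.Modules.pushforward p).obj N :=
    (Scheme.Modules.pullbackPushforwardAdjunction p).unit.app (Omega r)
  let n : Γ(N, (p ≫ j) ⁻¹ᵁ V) := η.app (j ⁻¹ᵁ V) w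
  let D (O : Z.Opens) (y : Γ(Z, O)) : Γ(N, O) :=
    Δ.app (hP O) y • N.presheaf.map (homOfLE (hP O)).op n
  have hD (O : Z.Opens) : IsDerivationAlong (RingHom.id Γ(Z, O)) (D O) := by
    constructor <;> intro a b
    · simp only [D, (Δ.app_isDerivationAlong (hP O)).map_add, add_smul]
    · simp only [D, (Δ.app_isDerivationAlong (hP O)).leibniz, add_smul, smul_eq_mul, mul_smul]
  have hDres (O O' : Z.Opens) (i : O' ⟶ O) (y : Γ(Z, O)) :
      D O' (Z.presheaf.map i.op y) = N.presheaf.map i.op (D O y) := by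
    simp only [D]
    rw [Scheme.Modules.map_smul, ← Δ.app_map (hP O) i]
    congr 1
    rw [← ConcreteCategory.comp_apply, ← Functor.map_comp]
    rfl
  let F (O : S.Opens) (a : Γ(S, O)) : Γ(N, p ⁻¹ᵁ O) :=
    η.app O ((univDer r).d (X := .op O) a)
  have hη (O : S.Opens) : IsDerivationAlong (p.app O).hom (F O) := by
    constructor <;> intro a b
    · refine (congrArg (η.app O) ((univDer_isDerivationAlong r O).map_add a b)).trans ?_
      exact map_add (η.app O).hom _ _
    · refine (congrArg (η.app O) ((univDer_isDerivationAlong r O).leibniz a b)).trans ?_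
      refine (map_add (η.app O).hom _ _).trans ?_
      exact congrArg₂ (· + ·) (Scheme.Modules.Hom.app_smul η a _)
        (Scheme.Modules.Hom.app_smul η b _)
  have hηres (O O' : S.Opens) (i : O' ⟶ O) (a : Γ(S, O)) :
      F O' (S.presheaf.map i.op a) =
        N.presheaf.map ((TopologicalSpace.Opens.map p.base).map i).op (F O a) := by
    refine (congrArg (η.app O') ((univDer r).d_map i.op a)).trans ?_
    exact congr($(η.mapPresheaf.naturality i.op) ((univDer r).d (X := .op O) a))
  -- Both sides are derivations along `p^♯` compatible with restriction, so it suffices to compare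
  -- them on functions from `V`.
  have key (O : S.Opens) (a : Γ(S, O)) :
      D (p ⁻¹ᵁ O) (p.app O a) = F O a := by
    refine sub_eq_zero.mp (eq_zero_of_surjectiveOnStalks p j hj hV hjV N
      (fun O a => D (p ⁻¹ᵁ O) (p.app O a) - F O a)
      (fun O => ((hD (p ⁻¹ᵁ O)).comp (p.app O).hom).sub (hη O)) (fun O O' i a => ?_)
      (fun a => ?_) O a)
    · refine Eq.trans ?_ (map_sub (N.presheaf.map
        ((TopologicalSpace.Opens.map p.base).map i).op).hom _ _).symm
      refine congrArg₂ (· - ·) ?_ (hηres O O' i a)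
      refine Eq.trans ?_ (hDres _ _ ((TopologicalSpace.Opens.map p.base).map i) _)
      exact congrArg (D (p ⁻¹ᵁ O')) congr($(p.naturality i.op) a)
    · refine sub_eq_zero.mpr ((?_ : _ = _).trans (congrArg (η.app (j ⁻¹ᵁ V)) (hw a)).symm)
      refine Eq.trans ?_ (Scheme.Modules.Hom.app_smul η (j.app V (δ a)) w).symm
      have h1 : Δ.app (hP (p ⁻¹ᵁ j ⁻¹ᵁ V)) (p.app (j ⁻¹ᵁ V) (j.app V a)) =
          p.app (j ⁻¹ᵁ V) (j.app V (δ a)) := by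
        rw [StalkDerivation.app_eq_iff]
        intro z hz
        exact hΔ z hz a
      refine congrArg₂ (fun (s : Γ(Z, p ⁻¹ᵁ j ⁻¹ᵁ V)) (m : Γ(N, p ⁻¹ᵁ j ⁻¹ᵁ V)) => s • m) h1 ?_
      exact congr($(N.presheaf.map_id _) n)
  let D' : Der (p ≫ r) N :=
    { d := fun {O} => AddMonoidHom.mk' (D O.unop) (hD O.unop).map_add
      d_mul := fun {O} a b => (hD O.unop).leibniz a b
      d_map := fun {O O'} i a => hDres O.unop O'.unop i.unop a
      d_app := fun {O} a => by
        refine (key (r ⁻¹ᵁ O.unop) (r.app O.unop a)).trans ?_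
        refine (congrArg (η.app _) ((univDer r).d_app a)).trans ?_
        exact map_zero (η.app _).hom }
  refine nonempty_splitting_diffSequence p r (desc D') fun O a => ?_
  refine (desc_app_univDer D' (p ⁻¹ᵁ O) (p.app O a)).trans ?_
  exact key O a

end SchemeDiff

/-! ### The splitting for a family dominated by a trivial one -/

theorem proposition2p1 {k : Type u} [Field k] [CharZero k]
    {C X Y : Scheme.{u}} (c : C ⟶ Spec (CommRingCat.of k))
    (hC : SchemeDiff.IsSmoothProjectiveCurve c)
    (pX : X ⟶ C) (pY : Y ⟶ C)
    (hpX : SchemeDiff.IsProjective pX) (hpY : SchemeDiff.IsProjective pY)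
    (hY : IsReduced Y)
    (hX : SchemeDiff.IsTrivialFamily c pX)
    (g : X ⟶ Y) (hg : g ≫ pY = pX)
    (hgc : IsIso g.c)
    (U : C.Opens) (hU : Flat (pY ∣_ U)) (Q : C) (hQ : Q ∈ U) :
    Nonempty (SchemeDiff.diffSequence
      (pullback.snd pY (C.fromSpecStalk Q)) (C.fromSpecStalk Q ≫ c)).Splitting := by
  have := hC.smooth
  obtain ⟨W, hW, V, hV, hQV, e, hst⟩ :=
    SmoothOfRelativeDimension.exists_isStandardSmoothOfRelativeDimension (n := 1) (f := c) Q
  obtain ⟨δ, hδ, hδ0, huniv⟩ := IsDerivationAlong.exists_of_isStandardSmooth _ hst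
  set j := C.fromSpecStalk Q with hj
  -- The points of the spectrum of the local ring at `Q` map to generizations of `Q`, which lie in
  -- every open neighbourhood of `Q`.
  have hjV (y) : j y ∈ V := by
    have : j y ∈ Set.range j := ⟨y, rfl⟩
    rw [hj, Scheme.range_fromSpecStalk] at this
    exact this.mem_open V.isOpen hQV
  have hl : StalkDerivation.Lifts pX V δ := by
    obtain ⟨X₀, x₀, i, hi⟩ := hX
    have H : IsPullback (i.hom ≫ pullback.fst x₀ c) pX x₀ c :=
      .of_iso (.of_hasPullback x₀ c) i.symm (.refl _) (.refl _) (.refl _)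
        (by simp) (by simp [← hi]) (by simp) (by simp)
    exact .of_isPullback H hW hV e hδ hδ0
  subst hg
  have hgb (O : Y.Opens) : Function.Bijective (g.app O) := by
    have : IsIso (g.app O) := inferInstanceAs (IsIso (g.c.app (.op O)))
    exact ConcreteCategory.bijective_of_isIso (g.app O)
  -- The vector field descends from `X` to `Y` and then restricts to `Y_R`: the projection to `Y` is
  -- a base change of `j`, hence a flat preimmersion.
  have hl' := (hl.of_comp hgb).comp (j := pullback.fst pY j)
    (Scheme.Hom.bijective_stalkMap_of_isPreimmersion_of_flat _)
  rw [pullback.condition] at hl'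
  -- The universal property of `δ` is applied to the derivation sending a function on `V` to its
  -- differential on the spectrum of the local ring.
  obtain ⟨w, hw⟩ := huniv (N := Γ(SchemeDiff.Omega (j ≫ c), j ⁻¹ᵁ V)) (j.app V).hom
    (fun a => (SchemeDiff.univDer (j ≫ c)).d (X := .op (j ⁻¹ᵁ V)) (j.app V a))
    ((SchemeDiff.univDer_isDerivationAlong _ _).comp (j.app V).hom) (fun a => SchemeDiff.univDer_app_appLE j c e a)
  exact SchemeDiff.nonempty_splitting_of_lifts _ _ j (j.stalkMap_surjective) hV hjV hl' w hw
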